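/- Let $n,m\in\mathbb{N}$, let $f,g_1,\dots,g_m\in\mathbb{R}[X]=\mathbb{R}[X_1,\dots,X_n]$, let $K:=\{x\in\mathbb{R}^n : g_j(x)\ge 0,\ j=1,\dots,m\}$, let $f^*:=\inf_{x\in K} f(x)$ (with $f^*=+\infty$ if $K=\emptyset$), and let $d:=\max\bigl[\lceil(\deg f)/2\rceil,\ \max_j\lceil(\deg g_j)/2\rceil\bigr]$, where the zero polynomial is given degree $0$. For a real sequence $y=(y_\alpha)_{\alpha\in\mathbb{N}^n}$ let $L_y:\mathbb{R}[X]\to\mathbb{R}$ be the linear functional $\sum_\alpha p_\alpha X^\alpha\mapsto\sum_\alpha p_\alpha y_\alpha$, and let $M_k(y)$ be the moment matrix with entries $M_k(y)(\alpha,\beta)=y_{\alpha+\beta}$ for $\alpha,\beta\in\mathbb{N}^n$ with $|\alpha|,|\beta|\le k$. Consider the semidefinite relaxation $$\widehat{\mathbf Q}:\quad \inf_y\ \{\,L_y(f)\ :\ M_d(y)\succeq 0,\ \ L_y(g_j)\ge 0\ (j=1,\dots,m),\ \ y_0=1\,\}$$ and its dual $$\widehat{\mathbf Q}^*:\quad \sup_{\gamma,\sigma_0,\lambda}\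 \Bigl\{\,\gamma\ :\ f-\gamma=\sigma_0+\sum_{j=1}^m\lambda_j g_j,\ \ \sigma_0 \text{ a sum of squares of polynomials},\ \deg\sigma_0\le 2d,\ \ \lambda_j\ge 0\ (j=1,\dots,m)\,\Bigr\}.$$ Either problem is called exact if its optimal value equals $f^*$. Let $$Q_c(g):=\Bigl\{\,\sigma_0+\sum_{j=1}^m\lambda_j g_j\ :\ \lambda_j\ge 0,\ \sigma_0 \text{ a sum of squares of polynomials that is convex on } \mathbb{R}^n\Bigr\}.$$ (a) If $f^*$ is finite and $f-f^*\in Q_c(g)$, then $\widehat{\mathbf Q}$ and $\widehat{\mathbf Q}^*$ are both exact. (b) If $f$ and $-g_1,\dots,-g_m$ are convex on $\mathbb{R}^n$, and if $y$ is an optimal solution of $\widehat{\mathbf Q}$ which satisfies $\operatorname{rank} M_d(y)=\operatorname{rank} M_{d-1}(y)$ (where, if $d=0$, $M_{d-1}(y)$ is read as $M_0(y)$), then $\widehat{\mathbf Q}$ is exact, and the point $x^*:=(L_y(X_1),\dots,L_y(X_n))$ belongs to $K$ and is a global minimizer of $f$ on $K$. -/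

import Mathlib

open MvPolynomial

noncomputable section

namespace SimplifiedRelaxation

/-- The exponents `α ∈ ℕⁿ` with `|α| = ∑ i, α i ≤ k`. -/
abbrev Exponents (n k : ℕ) : Type := {α : Fin n →₀ ℕ // α.degree ≤ k}

theorem finite_exponents (n k : ℕ) : Finite (Exponents n k) :=
  (Finsupp.finite_of_degree_le (σ := Fin n) k).to_subtype

instance instFintypeExponents (n k : ℕ) : Fintype (Exponents n k) :=
  @Fintype.ofFinite _ (finite_exponents n k)

/-- The Riesz functional `L_y : p = ∑ p_α X^α ↦ ∑ p_α y_α` of a sequence `y = (y_α)`. -/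
def riesz {n : ℕ} (y : (Fin n →₀ ℕ) → ℝ) (p : MvPolynomial (Fin n) ℝ) : ℝ :=
  ∑ α ∈ p.support, p.coeff α * y α

/-- The moment matrix `M_k(y)`, with entries `y_{α+β}` for `|α|, |β| ≤ k`. -/
def momentMatrix {n : ℕ} (k : ℕ) (y : (Fin n →₀ ℕ) → ℝ) :
    Matrix (Exponents n k) (Exponents n k) ℝ :=
  Matrix.of fun α β => y (α.1 + β.1)

/-- The basic semi-algebraic set `K = {x : g_j(x) ≥ 0 for all j}`. -/
def feasibleSet {n m : ℕ} (g : Fin m → MvPolynomial (Fin n) ℝ) : Set (Fin n → ℝ) :=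
  {x | ∀ j, 0 ≤ eval x (g j)}

/-- A polynomial is convex when its polynomial function is convex on `ℝⁿ`. -/
def IsConvexPoly {n : ℕ} (p : MvPolynomial (Fin n) ℝ) : Prop :=
  ConvexOn ℝ Set.univ fun x : Fin n → ℝ => eval x p

/-- `Q_c(g)`: the polynomials `σ₀ + ∑ j, λ_j g_j` with `σ₀` a convex sum of squares and
`λ_j ≥ 0`. -/
def convexModule {n m : ℕ} (g : Fin m → MvPolynomial (Fin n) ℝ) :
    Set (MvPolynomial (Fin n) ℝ) :=
  {p | ∃ (σ : MvPolynomial (Fin n) ℝ) (l : Fin m → ℝ),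
    IsSumSq σ ∧ IsConvexPoly σ ∧ (∀ j, 0 ≤ l j) ∧ p = σ + ∑ j, C (l j) * g j}

/-- The infimum `f*` of `f` on `K`, as an extended real (`⊤` if `K` is empty). -/
def optimalValue {n m : ℕ} (f : MvPolynomial (Fin n) ℝ)
    (g : Fin m → MvPolynomial (Fin n) ℝ) : EReal :=
  ⨅ x ∈ feasibleSet g, ((eval x f : ℝ) : EReal)

/-- `d = max (⌈deg f / 2⌉, max_j ⌈deg g_j / 2⌉)`. -/
def relaxationOrder {n m : ℕ} (f : MvPolynomial (Fin n) ℝ)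
    (g : Fin m → MvPolynomial (Fin n) ℝ) : ℕ :=
  max (f.totalDegree ⌈/⌉ 2) (Finset.univ.sup fun j => (g j).totalDegree ⌈/⌉ 2)

/-- The feasible set of the simplified relaxation: `y_0 = 1`, `M_d(y) ⪰ 0` and
`L_y(g_j) ≥ 0` for all `j`. -/
def primalFeasible {n m : ℕ} (f : MvPolynomial (Fin n) ℝ)
    (g : Fin m → MvPolynomial (Fin n) ℝ) : Set ((Fin n →₀ ℕ) → ℝ) :=
  {y | (momentMatrix (relaxationOrder f g) y).PosSemidef ∧ (∀ j, 0 ≤ riesz y (g j)) ∧ y 0 = 1}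

/-- The optimal value of the simplified relaxation. -/
def primalValue {n m : ℕ} (f : MvPolynomial (Fin n) ℝ)
    (g : Fin m → MvPolynomial (Fin n) ℝ) : EReal :=
  ⨅ y ∈ primalFeasible f g, ((riesz y f : ℝ) : EReal)

/-- `y` is an optimal solution of the simplified relaxation. -/
def IsPrimalOptimal {n m : ℕ} (f : MvPolynomial (Fin n) ℝ)
    (g : Fin m → MvPolynomial (Fin n) ℝ) (y : (Fin n →₀ ℕ) → ℝ) : Prop :=
  y ∈ primalFeasible f g ∧ ∀ z ∈ primalFeasible f g, riesz y f ≤ riesz z f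

/-- The feasible triplets `(γ, σ₀, λ)` of the dual: `f - γ = σ₀ + ∑ j, λ_j g_j`, with `σ₀` a sum
of squares of degree at most `2d` and `λ_j ≥ 0`. -/
def dualFeasible {n m : ℕ} (f : MvPolynomial (Fin n) ℝ)
    (g : Fin m → MvPolynomial (Fin n) ℝ) :
    Set (ℝ × MvPolynomial (Fin n) ℝ × (Fin m → ℝ)) :=
  {t | f - C t.1 = t.2.1 + ∑ j, C (t.2.2 j) * g j ∧
    IsSumSq t.2.1 ∧ t.2.1.totalDegree ≤ 2 * relaxationOrder f g ∧ ∀ j, 0 ≤ t.2.2 j}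

/-- The optimal value of the dual of the simplified relaxation. -/
def dualValue {n m : ℕ} (f : MvPolynomial (Fin n) ℝ)
    (g : Fin m → MvPolynomial (Fin n) ℝ) : EReal :=
  ⨆ t ∈ dualFeasible f g, ((t.1 : ℝ) : EReal)

end SimplifiedRelaxation

end

noncomputable section

namespace SimplifiedRelaxation

/-! ### The Riesz functional and the quadratic form of the moment matrix. -/

section Riesz

variable {n : ℕ}

/-! Part (a) is a sandwich. Weak duality and the moment sequences of points of `K` give dual ≤
primal ≤ `f*`, and the certificate for `f - f*` is itself dual feasible with value `f*`.

Part (b) rests on flatness (Curto–Fialkow): the rank condition makes `y`, up to degree `2d`, the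
moments of a finitely atomic probability measure (`exists_atoms_of_rank_eq`; `d = 0` is trivial).
Its atoms are joint eigenvalues of commuting symmetric "multiplication by `X_i`" operators on the
Gram space of `M_d(y)`. The mean of the measure is `x*`, so Jensen applied to `-g_j` gives `g_j(x*)
≥ L_y(g_j) ≥ 0`, and applied to `f` gives `f(x*) ≤ L_y(f) ≤ f*`. -/

theorem riesz_eq_sum_of_support_subset (y : (Fin n →₀ ℕ) → ℝ) {p : MvPolynomial (Fin n) ℝ}
    {s : Finset (Fin n →₀ ℕ)} (h : p.support ⊆ s) :
    riesz y p = ∑ α ∈ s, p.coeff α * y α :=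
  Finset.sum_subset h fun α _ hα => by rw [notMem_support_iff.1 hα, zero_mul]

/-- The Riesz functional as a linear map. -/
def rieszLinear (y : (Fin n →₀ ℕ) → ℝ) : MvPolynomial (Fin n) ℝ →ₗ[ℝ] ℝ where
  toFun := riesz y
  map_add' p q := by
    classical
    rw [riesz_eq_sum_of_support_subset y (support_add (p := p) (q := q)),
      riesz_eq_sum_of_support_subset y (Finset.subset_union_left (s₂ := q.support)),
      riesz_eq_sum_of_support_subset y (Finset.subset_union_right (s₁ := p.support)),
      ← Finset.sum_add_distrib]
    exact Finset.sum_congr rfl fun α _ => by rw [coeff_add, add_mul]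
  map_smul' c p := by
    rw [riesz_eq_sum_of_support_subset y (support_smul (a := c) (f := p)), RingHom.id_apply,
      riesz, smul_eq_mul, Finset.mul_sum]
    exact Finset.sum_congr rfl fun α _ => by rw [coeff_smul, smul_eq_mul, mul_assoc]

theorem rieszLinear_apply (y : (Fin n →₀ ℕ) → ℝ) (p : MvPolynomial (Fin n) ℝ) :
    rieszLinear y p = riesz y p := rfl

theorem riesz_monomial (y : (Fin n →₀ ℕ) → ℝ) (α : Fin n →₀ ℕ) (c : ℝ) :
    riesz y (monomial α c) = c * y α := by
  rw [riesz_eq_sum_of_support_subset y support_monomial_subset]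
  simp

theorem riesz_C (y : (Fin n →₀ ℕ) → ℝ) (c : ℝ) : riesz y (C c) = c * y 0 :=
  riesz_monomial y 0 c

theorem eval_eq_riesz (x : Fin n → ℝ) (p : MvPolynomial (Fin n) ℝ) :
    eval x p = riesz (fun α => ∏ i, x i ^ α i) p :=
  eval_eq' x p

theorem degree_le_of_mem_support {p : MvPolynomial (Fin n) ℝ} {k : ℕ} (hp : p.totalDegree ≤ k)
    {α : Fin n →₀ ℕ} (hα : α ∈ p.support) : α.degree ≤ k :=
  (le_totalDegree hα).trans hp

theorem sum_exponents_monomial {p : MvPolynomial (Fin n) ℝ} {k : ℕ} (hp : p.totalDegree ≤ k) :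
    ∑ a : Exponents n k, monomial a.1 (p.coeff a.1) = p := by
  classical
  conv_rhs => rw [p.as_sum]
  rw [← Finset.sum_subtype_of_mem (p := fun α : Fin n →₀ ℕ => α.degree ≤ k)
    (fun α => monomial α (p.coeff α)) fun α hα => degree_le_of_mem_support hp hα]
  refine (Finset.sum_subset (Finset.subset_univ _) fun a _ ha => ?_).symm
  rw [Finset.mem_subtype, notMem_support_iff] at ha
  rw [ha, monomial_zero]

/-- `L_y(q²)` is the quadratic form of `M_k(y)` at the coefficient vector of `q`. -/
theorem riesz_mul_self_nonneg {k : ℕ} {y : (Fin n →₀ ℕ) → ℝ}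
    (hy : (momentMatrix k y).PosSemidef) {q : MvPolynomial (Fin n) ℝ} (hq : q.totalDegree ≤ k) :
    0 ≤ riesz y (q * q) := by
  have h := hy.dotProduct_mulVec_nonneg fun a => q.coeff a.1
  refine h.trans_eq (Eq.symm ?_)
  nth_rw 1 2 [← sum_exponents_monomial hq]
  rw [← rieszLinear_apply, Finset.sum_mul_sum, map_sum]
  simp only [dotProduct, Matrix.mulVec, momentMatrix, Matrix.of_apply, Pi.star_apply, star_trivial,
    map_sum, Finset.mul_sum, monomial_mul, rieszLinear_apply, riesz_monomial]
  exact Finset.sum_congr rfl fun a _ => Finset.sum_congr rfl fun b _ => by ring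

end Riesz

/-! ### Degrees in sums of squares. -/

section SumsOfSquares

variable {σ : Type*}

theorem exists_list_of_isSumSq {R : Type*} [Semiring R] {p : R} (hp : IsSumSq p) :
    ∃ l : List R, p = (l.map fun q => q * q).sum := by
  induction hp with
  | zero => exact ⟨[], by simp⟩
  | sq_add a _ ih =>
    obtain ⟨l, rfl⟩ := ih
    exact ⟨a :: l, by simp⟩

theorem totalDegree_le_of_homogeneousComponent_eq_zero {R : Type*} [CommSemiring R]
    {p : MvPolynomial σ R} {k : ℕ} (hp : p.totalDegree ≤ k + 1)
    (h : homogeneousComponent (k + 1) p = 0) : p.totalDegree ≤ k := by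
  refine Finset.sup_le fun α hα => ?_
  have h₁ : α.degree ≤ k + 1 := (le_totalDegree hα).trans hp
  have h₂ : α.degree ≠ k + 1 := fun h₂ => by
    have := coeff_homogeneousComponent (k + 1) p α
    rw [h, if_pos h₂, coeff_zero] at this
    exact mem_support_iff.1 hα this.symm
  change α.degree ≤ k
  omega

theorem homogeneousComponent_mul_of_totalDegree_le {R : Type*} [CommSemiring R]
    {p q : MvPolynomial σ R} {j k : ℕ} (hp : p.totalDegree ≤ j) (hq : q.totalDegree ≤ k) :
    homogeneousComponent (j + k) (p * q) =
      homogeneousComponent j p * homogeneousComponent k q := by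
  classical
  ext α
  rw [coeff_homogeneousComponent]
  split_ifs with hα
  · rw [coeff_mul, coeff_mul]
    refine Finset.sum_congr rfl fun x hx => ?_
    rw [Finset.HasAntidiagonal.mem_antidiagonal] at hx
    have hdeg : x.1.degree + x.2.degree = j + k := by rw [← map_add, hx, hα]
    rw [coeff_homogeneousComponent, coeff_homogeneousComponent]
    rcases lt_trichotomy x.1.degree j with h | h | h
    · have : coeff x.2 q = 0 := coeff_eq_zero_of_totalDegree_lt (by
        change q.totalDegree < x.2.degree
        omega)
      simp [this]
    · rw [if_pos h, if_pos (by omega)]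
    · have : coeff x.1 p = 0 := coeff_eq_zero_of_totalDegree_lt (by
        change p.totalDegree < x.1.degree
        omega)
      simp [this]
  · exact (((homogeneousComponent_isHomogeneous j p).mul
      (homogeneousComponent_isHomogeneous k q)).coeff_eq_zero hα).symm

theorem list_eq_zero_of_sum_mul_self_eq_zero {l : List ℝ} (h : (l.map fun a => a * a).sum = 0) :
    ∀ a ∈ l, a = 0 := by
  induction l with
  | nil => simp
  | cons b l ih =>
    have hl : 0 ≤ (l.map fun a => a * a).sum := List.sum_nonneg fun x hx => by
      obtain ⟨a, -, rfl⟩ := List.mem_map.1 hx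
      exact mul_self_nonneg a
    rw [List.map_cons, List.sum_cons] at h
    have hb : b * b = 0 := le_antisymm (by linarith) (mul_self_nonneg b)
    rw [hb, zero_add] at h
    simpa [mul_self_eq_zero.1 hb] using ih h

/-- Leading forms of real squares cannot cancel: above degree `2k` the top component of the sum is a
vanishing sum of squares of forms, so each form is zero and the degree bound drops by one. -/
theorem totalDegree_le_of_totalDegree_sum_mul_self_le {l : List (MvPolynomial σ ℝ)} {k : ℕ}
    (hl : ((l.map fun q => q * q).sum).totalDegree ≤ 2 * k) : ∀ q ∈ l, q.totalDegree ≤ k := by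
  have descent : ∀ i, (∀ q ∈ l, q.totalDegree ≤ k + i) → ∀ q ∈ l, q.totalDegree ≤ k := by
    intro i
    induction i with
    | zero => exact id
    | succ i ih =>
      intro h
      refine ih fun q hq => totalDegree_le_of_homogeneousComponent_eq_zero (h q hq) ?_
      refine MvPolynomial.funext fun x => ?_
      have hsum : ((l.map fun q => eval x (homogeneousComponent (k + i + 1) q)).map
          fun a => a * a).sum = 0 := by
        have h0 : eval x (homogeneousComponent (k + i + 1 + (k + i + 1))
            (l.map fun q => q * q).sum) = 0 := by
          rw [homogeneousComponent_eq_zero _ _ (by omega), map_zero]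
        rw [map_list_sum, map_list_sum, List.map_map, List.map_map] at h0
        rw [← h0, List.map_map]
        refine congrArg List.sum (List.map_congr_left fun q hq => ?_)
        simp only [Function.comp_apply]
        rw [homogeneousComponent_mul_of_totalDegree_le (j := k + i + 1) (k := k + i + 1)
          (h q hq) (h q hq), map_mul]
      rw [map_zero]
      exact list_eq_zero_of_sum_mul_self_eq_zero hsum _ (List.mem_map_of_mem hq)
  -- The sum of all the degrees is a crude bound from which to start the descent.
  refine descent (l.map totalDegree).sum fun q hq => ?_
  exact (List.single_le_sum (by simp) _ (List.mem_map_of_mem hq)).trans (Nat.le_add_left _ _)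

theorem riesz_nonneg_of_isSumSq {n k : ℕ} {y : (Fin n →₀ ℕ) → ℝ}
    (hy : (momentMatrix k y).PosSemidef) {p : MvPolynomial (Fin n) ℝ} (hp : IsSumSq p)
    (hk : p.totalDegree ≤ 2 * k) : 0 ≤ riesz y p := by
  obtain ⟨l, rfl⟩ := exists_list_of_isSumSq hp
  rw [← rieszLinear_apply, map_list_sum, List.map_map]
  refine List.sum_nonneg fun x hx => ?_
  obtain ⟨q, hq, rfl⟩ := List.mem_map.1 hx
  exact riesz_mul_self_nonneg hy (totalDegree_le_of_totalDegree_sum_mul_self_le hk q hq)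

end SumsOfSquares

/-! ### Weak duality and the comparison with `f*`. -/

section Values

variable {n m : ℕ} (f : MvPolynomial (Fin n) ℝ) (g : Fin m → MvPolynomial (Fin n) ℝ)

theorem totalDegree_objective_le : f.totalDegree ≤ 2 * relaxationOrder f g := by
  have h : f.totalDegree ⌈/⌉ 2 ≤ relaxationOrder f g := le_max_left _ _
  rw [Nat.ceilDiv_eq_add_pred_div] at h
  omega

theorem totalDegree_constraint_le (j : Fin m) :
    (g j).totalDegree ≤ 2 * relaxationOrder f g := by
  have h : (g j).totalDegree ⌈/⌉ 2 ≤ relaxationOrder f g :=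
    (Finset.le_sup (f := fun j => (g j).totalDegree ⌈/⌉ 2) (Finset.mem_univ j)).trans
      (le_max_right _ _)
  rw [Nat.ceilDiv_eq_add_pred_div] at h
  omega

/-- These are the moments of the Dirac measure at `x`; the moment matrix is a rank-one `v vᵀ`. -/
theorem monomials_mem_primalFeasible {x : Fin n → ℝ} (hx : x ∈ feasibleSet g) :
    (fun α : Fin n →₀ ℕ => ∏ i, x i ^ α i) ∈ primalFeasible f g := by
  refine ⟨?_, fun j => ?_, by simp⟩
  · convert Matrix.posSemidef_vecMulVec_self_star
      fun a : Exponents n (relaxationOrder f g) => ∏ i, x i ^ a.1 i using 1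
    ext a b
    simp [momentMatrix, Matrix.vecMulVec_apply, pow_add, Finset.prod_mul_distrib]
  · rw [← eval_eq_riesz]
    exact hx j

theorem primalValue_le_optimalValue : primalValue f g ≤ optimalValue f g :=
  le_iInf₂ fun x hx => (iInf₂_le _ (monomials_mem_primalFeasible f g hx)).trans_eq
    (by rw [← eval_eq_riesz])

theorem dualValue_le_primalValue : dualValue f g ≤ primalValue f g := by
  refine iSup₂_le fun t ht => le_iInf₂ fun y hy => EReal.coe_le_coe_iff.2 ?_
  obtain ⟨heq, hsq, hdeg, hl⟩ := ht
  obtain ⟨hpsd, hg, h0⟩ := hy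
  have h := congrArg (rieszLinear y) heq
  simp only [map_sub, map_add, map_sum, C_mul', map_smul, rieszLinear_apply, riesz_C, h0, mul_one,
    smul_eq_mul] at h
  have h₁ := riesz_nonneg_of_isSumSq hpsd hsq hdeg
  have h₂ : 0 ≤ ∑ j, t.2.2 j * riesz y (g j) :=
    Finset.sum_nonneg fun j _ => mul_nonneg (hl j) (hg j)
  linarith

theorem le_dualValue_of_sub_mem_convexModule {c : ℝ} (h : f - C c ∈ convexModule g) :
    (c : EReal) ≤ dualValue f g := by
  obtain ⟨s, l, hs, -, hl, heq⟩ := h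
  have hdeg : s.totalDegree ≤ 2 * relaxationOrder f g := by
    -- The degree bound is automatic: `s = f - c - ∑ λ_j g_j`, whose terms all have degree at most
    -- `2d`.
    rw [← sub_eq_iff_eq_add.2 heq]
    refine (totalDegree_sub _ _).trans (max_le ?_ ?_)
    · refine (totalDegree_sub _ _).trans (max_le (totalDegree_objective_le f g) ?_)
      rw [totalDegree_C]
      exact Nat.zero_le _
    · refine totalDegree_finsetSum_le fun j _ => ?_
      rw [C_mul']
      exact (totalDegree_smul_le _ _).trans (totalDegree_constraint_le f g j)
  exact le_iSup₂_of_le (c, s, l) ⟨heq, hs, hdeg, hl⟩ le_rfl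

end Values


/-! ### Gram vectors and rank. -/

section Gram

theorem exists_gram_of_posSemidef {ι : Type*} [Finite ι] {M : Matrix ι ι ℝ}
    (hM : M.PosSemidef) :
    ∃ (k : ℕ) (v : ι → EuclideanSpace ℝ (Fin k)), ∀ i j, inner ℝ (v i) (v j) = M i j := by
  obtain ⟨k, u, rfl⟩ := Matrix.posSemidef_iff_eq_sum_vecMulVec.1 hM
  refine ⟨k, fun i => WithLp.toLp 2 fun t => u t i, fun i j => ?_⟩
  simp [Matrix.sum_apply, Matrix.vecMulVec_apply, PiLp.inner_apply, mul_comm]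

theorem rank_gram {ι E : Type*} [Fintype ι] [NormedAddCommGroup E] [InnerProductSpace ℝ E]
    [FiniteDimensional ℝ E] (v : ι → E) :
    (Matrix.gram ℝ v).rank = Module.finrank ℝ (Submodule.span ℝ (Set.range v)) := by
  have b := stdOrthonormalBasis ℝ E
  rw [Matrix.gram_eq_conjTranspose_mul b, Matrix.rank_conjTranspose_mul_self,
    Matrix.rank_eq_finrank_span_cols]
  let e : E ≃ₗ[ℝ] (Fin (Module.finrank ℝ E) → ℝ) :=
    b.repr.toLinearEquiv.trans (WithLp.linearEquiv 2 ℝ _)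
  rw [← LinearEquiv.finrank_map_eq e, Submodule.map_span, ← Set.range_comp]
  rfl

end Gram

/-! ### Symmetric operators and their joint spectrum. -/

section JointSpectrum

variable {E : Type*} [NormedAddCommGroup E] [InnerProductSpace ℝ E]

theorem eq_zero_of_forall_inner_eq_zero {ι : Type*} {u : ι → E}
    (hu : Submodule.span ℝ (Set.range u) = ⊤) {x : E} (h : ∀ i, inner ℝ x (u i) = 0) : x = 0 := by
  have hx : x ∈ Submodule.span ℝ (Set.range u) := hu ▸ Submodule.mem_top
  have : ∀ z ∈ Submodule.span ℝ (Set.range u), inner ℝ x z = 0 := fun z hz => by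
    induction hz using Submodule.span_induction with
    | mem z hz => obtain ⟨i, rfl⟩ := hz; exact h i
    | zero => exact inner_zero_right x
    | add a b _ _ ha hb => rw [inner_add_right, ha, hb, add_zero]
    | smul c a _ ha => rw [inner_smul_right, ha, mul_zero]
  exact inner_self_eq_zero.1 (this x hx)

theorem ext_inner_spanning {ι : Type*} {u : ι → E}
    (hu : Submodule.span ℝ (Set.range u) = ⊤) {x z : E}
    (h : ∀ i, inner ℝ x (u i) = inner ℝ z (u i)) : x = z :=
  sub_eq_zero.1 <| eq_zero_of_forall_inner_eq_zero hu fun i => by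
    rw [inner_sub_left, h, sub_self]

/-- A family of prescribed values on a spanning family which is formally symmetric extends to a
symmetric operator. -/
theorem exists_isSymmetric_of_inner_eq {ι : Type*} {u w : ι → E}
    (hu : Submodule.span ℝ (Set.range u) = ⊤)
    (h : ∀ i j, inner ℝ (w i) (u j) = inner ℝ (u i) (w j)) :
    ∃ T : E →ₗ[ℝ] E, T.IsSymmetric ∧ ∀ i, T (u i) = w i := by
  let U := Finsupp.linearCombination ℝ u
  let W := Finsupp.linearCombination ℝ w
  have hUW : ∀ a b, inner ℝ (W a) (U b) = inner ℝ (U a) (W b) := fun a b => by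
    simp only [U, W, Finsupp.linearCombination_apply, Finsupp.sum, sum_inner, inner_sum,
      inner_smul_left, inner_smul_right, h]
  have hsurj : LinearMap.range U = ⊤ := by rw [Finsupp.range_linearCombination, hu]
  obtain ⟨r, hr⟩ := U.exists_rightInverse_of_surjective hsurj
  have hUr : ∀ x, U (r x) = x := fun x => LinearMap.congr_fun hr x
  -- Well-definedness: by formal symmetry, `W a` is determined by `U a`.
  have hT : ∀ a, W (r (U a)) = W a := fun a => ext_inner_spanning hu fun j => by
    have hj : u j = U (Finsupp.single j 1) := by simp [U]
    rw [hj, hUW, hUW, hUr]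
  refine ⟨W ∘ₗ r, fun x z => ?_, fun i => ?_⟩
  · have := hUW (r x) (r z)
    rwa [hUr, hUr] at this
  · simpa [U, W] using hT (Finsupp.single i 1)

open Module.End in
/-- Joint diagonalization of a vector under commuting symmetric operators. -/
theorem exists_sum_joint_eigenvectors [FiniteDimensional ℝ E] {ι : Type*} {T : ι → E →ₗ[ℝ] E}
    (hT : ∀ i, (T i).IsSymmetric) (hc : ∀ i j, Commute (T i) (T j)) (x : E) :
    ∃ (s : Finset (ι → ℝ)) (e : (ι → ℝ) → E), (∀ χ i, T i (e χ) = χ i • e χ) ∧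
      (∀ χ ψ, χ ≠ ψ → inner ℝ (e χ) (e ψ) = 0) ∧ x = ∑ χ ∈ s, e χ := by
  have hx : x ∈ ⨆ χ : ι → ℝ, ⨅ i, eigenspace (T i) (χ i) := by
    rw [LinearMap.IsSymmetric.iSup_iInf_eq_top_of_commute hT fun i j _ => hc i j]
    exact Submodule.mem_top
  obtain ⟨e, he, rfl⟩ := (Submodule.mem_iSup_iff_exists_finsupp _ _).1 hx
  refine ⟨e.support, e, fun χ i => ?_, fun χ ψ hχ => ?_, rfl⟩
  · exact mem_eigenspace_iff.1 ((Submodule.mem_iInf _).1 (he χ) i)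
  · exact LinearMap.IsSymmetric.orthogonalFamily_iInf_eigenspaces hT hχ ⟨_, he χ⟩ ⟨_, he ψ⟩

end JointSpectrum

/-! ### Flat moment matrices have atomic representing measures. -/

section FlatExtension

variable {n : ℕ}

/-- Adding a unit exponent. -/
def Exponents.succ {k : ℕ} (i : Fin n) (a : Exponents n k) : Exponents n (k + 1) :=
  ⟨a.1 + Finsupp.single i 1, by
    rw [map_add, Finsupp.degree_single]
    exact Nat.add_le_add_right a.2 1⟩

/-- Regarding an exponent of degree at most `k` as one of degree at most `k + 1`. -/
def Exponents.castSucc {k : ℕ} (a : Exponents n k) : Exponents n (k + 1) :=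
  ⟨a.1, a.2.trans (Nat.le_succ k)⟩

theorem span_castSucc_eq_of_rank_eq {k : ℕ} {y : (Fin n →₀ ℕ) → ℝ} {E : Type*}
    [NormedAddCommGroup E] [InnerProductSpace ℝ E] [FiniteDimensional ℝ E]
    {v : Exponents n (k + 1) → E} (hv : ∀ a b, inner ℝ (v a) (v b) = y (a.1 + b.1))
    (hrank : (momentMatrix (k + 1) y).rank = (momentMatrix k y).rank) :
    Submodule.span ℝ (Set.range fun a : Exponents n k => v a.castSucc) =
      Submodule.span ℝ (Set.range v) := by
  have h₁ : momentMatrix (k + 1) y = Matrix.gram ℝ v := Matrix.ext fun a b => (hv a b).symm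
  have h₂ : momentMatrix k y = Matrix.gram ℝ fun a : Exponents n k => v a.castSucc :=
    Matrix.ext fun a b => (hv a.castSucc b.castSucc).symm
  rw [h₁, h₂, rank_gram, rank_gram] at hrank
  refine Submodule.eq_of_le_of_finrank_eq (Submodule.span_mono ?_) hrank.symm
  rintro _ ⟨a, rfl⟩
  exact ⟨a.castSucc, rfl⟩

/-- Here `v α` plays the class of `X^α`, and `T i` is multiplication by `X_i`. Splitting `v 0` into
orthogonal joint eigenvectors `e x` gives `v α = ∑ x^α e x`; the weights are the squared norms of
the `e x`. -/
theorem exists_atoms_of_spanning {k : ℕ} {y : (Fin n →₀ ℕ) → ℝ} {E : Type*}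
    [NormedAddCommGroup E] [InnerProductSpace ℝ E] [FiniteDimensional ℝ E]
    {v : Exponents n (k + 1) → E} (hv : ∀ a b, inner ℝ (v a) (v b) = y (a.1 + b.1))
    (hspan : Submodule.span ℝ (Set.range fun a : Exponents n k => v a.castSucc) = ⊤) :
    ∃ (s : Finset (Fin n → ℝ)) (w : (Fin n → ℝ) → ℝ), (∀ x, 0 ≤ w x) ∧
      ∀ α : Fin n →₀ ℕ, α.degree ≤ 2 * (k + 1) → y α = ∑ x ∈ s, w x * ∏ i, x i ^ α i := by
  have hex : ∀ i : Fin n, ∃ T : E →ₗ[ℝ] E, T.IsSymmetric ∧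
      ∀ a : Exponents n k, T (v a.castSucc) = v (a.succ i) := fun i =>
    exists_isSymmetric_of_inner_eq hspan fun a b => by
      rw [hv, hv]
      simp only [Exponents.succ, Exponents.castSucc]
      rw [add_right_comm, add_assoc]
  choose T hsymm hT using hex
  -- Moving one operator across the inner product turns both orders into the same moment without
  -- exceeding degree `k + 1` in either slot.
  have hcomm : ∀ i j, Commute (T i) (T j) := fun i j => by
    refine LinearMap.ext_on_range hspan fun a => ext_inner_spanning hspan fun b => ?_
    simp only [Module.End.mul_apply]
    rw [hT j a, hT i a, hsymm i, hsymm j, hT, hT, hv, hv]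
    simp only [Exponents.succ]
    congr 1
    abel
  obtain ⟨s, e, heig, horth, hone⟩ :=
    exists_sum_joint_eigenvectors hsymm hcomm (v ⟨0, by simp⟩)
  have hmon : ∀ (d : ℕ) (α : Fin n →₀ ℕ) (_ : α.degree = d) (h : α.degree ≤ k + 1),
      v ⟨α, h⟩ = ∑ x ∈ s, (∏ i, x i ^ α i) • e x := by
    intro d
    induction d with
    | zero =>
      intro α hd _
      obtain rfl := (Finsupp.degree_eq_zero_iff α).1 hd
      simpa using hone
    | succ d ih =>
      intro α hd h
      obtain ⟨i, hi⟩ : α.support.Nonempty := by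
        rw [Finsupp.support_nonempty_iff]
        rintro rfl
        simp at hd
      obtain ⟨β, rfl⟩ : ∃ β, α = β + Finsupp.single i 1 :=
        ⟨α - Finsupp.single i 1, (tsub_add_cancel_of_le (by
          rw [Finsupp.single_le_iff]
          exact Nat.one_le_iff_ne_zero.2 (Finsupp.mem_support_iff.1 hi))).symm⟩
      rw [map_add, Finsupp.degree_single] at hd
      have hβ : β.degree ≤ k := by
        rw [map_add, Finsupp.degree_single] at h
        omega
      have := hT i ⟨β, hβ⟩
      simp only [Exponents.succ, Exponents.castSucc] at this
      rw [← this, ih β (by omega) (by omega), map_sum]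
      refine Finset.sum_congr rfl fun x _ => ?_
      rw [map_smul, heig, smul_smul]
      congr 1
      simp only [Finsupp.add_apply, pow_add, Finset.prod_mul_distrib]
      have hsingle : ∏ j, x j ^ Finsupp.single i 1 j = x i := by
        rw [Finset.prod_eq_single_of_mem i (Finset.mem_univ i) fun j _ hj => by
          rw [Finsupp.single_eq_of_ne hj, pow_zero], Finsupp.single_eq_same, pow_one]
      rw [hsingle]
  refine ⟨s, fun x => inner ℝ (e x) (e x), fun x => real_inner_self_nonneg, fun α hα => ?_⟩
  obtain ⟨β, γ, rfl, hβ, hγ⟩ : ∃ β γ, α = β + γ ∧ β.degree ≤ k + 1 ∧ γ.degree ≤ k + 1 := by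
    obtain ⟨β, hle, hβ⟩ := α.exists_le_degree_eq (min α.degree (k + 1)) (min_le_left _ _)
    obtain ⟨γ, rfl⟩ := le_iff_exists_add.1 hle
    rw [map_add] at hα hβ
    exact ⟨β, γ, rfl, by omega, by omega⟩
  rw [← hv ⟨β, hβ⟩ ⟨γ, hγ⟩, hmon _ β rfl, hmon _ γ rfl, sum_inner]
  refine Finset.sum_congr rfl fun x hx => ?_
  rw [inner_sum, Finset.sum_eq_single_of_mem x hx fun z _ hz => by
    rw [inner_smul_left, inner_smul_right, horth x z hz.symm, mul_zero, mul_zero]]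
  simp only [inner_smul_left, inner_smul_right, Finsupp.add_apply, pow_add,
    Finset.prod_mul_distrib, conj_trivial]
  ring

/-- A positive semidefinite moment matrix of which the rank does not grow in the last step is
represented by a finitely atomic measure. -/
theorem exists_atoms_of_rank_eq {k : ℕ} {y : (Fin n →₀ ℕ) → ℝ}
    (hpsd : (momentMatrix (k + 1) y).PosSemidef)
    (hrank : (momentMatrix (k + 1) y).rank = (momentMatrix k y).rank) :
    ∃ (s : Finset (Fin n → ℝ)) (w : (Fin n → ℝ) → ℝ), (∀ x, 0 ≤ w x) ∧
      ∀ α : Fin n →₀ ℕ, α.degree ≤ 2 * (k + 1) → y α = ∑ x ∈ s, w x * ∏ i, x i ^ α i := by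
  obtain ⟨N, v, hv⟩ := exists_gram_of_posSemidef hpsd
  -- Restricting to the span of the Gram vectors turns flatness into spanning by those of degree at
  -- most `k`.
  let V := Submodule.span ℝ (Set.range v)
  let v' : Exponents n (k + 1) → V := fun a => ⟨v a, Submodule.subset_span ⟨a, rfl⟩⟩
  have hv' : ∀ a b, inner ℝ (v' a) (v' b) = y (a.1 + b.1) := hv
  refine exists_atoms_of_spanning hv' ?_
  rw [span_castSucc_eq_of_rank_eq hv' hrank]
  apply Submodule.map_injective_of_injective V.injective_subtype
  rw [Submodule.map_span, ← Set.range_comp, Submodule.map_top, Submodule.range_subtype]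
  rfl

end FlatExtension

/-! ### Jensen's inequality for the atomic measure. -/

section Jensen

variable {n : ℕ}

theorem riesz_eq_sum_eval {k : ℕ} {y : (Fin n →₀ ℕ) → ℝ} {s : Finset (Fin n → ℝ)}
    {w : (Fin n → ℝ) → ℝ}
    (hy : ∀ α : Fin n →₀ ℕ, α.degree ≤ k → y α = ∑ x ∈ s, w x * ∏ i, x i ^ α i)
    {p : MvPolynomial (Fin n) ℝ} (hp : p.totalDegree ≤ k) :
    riesz y p = ∑ x ∈ s, w x * eval x p := by
  simp only [eval_eq', Finset.mul_sum]
  rw [Finset.sum_comm, riesz]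
  refine Finset.sum_congr rfl fun α hα => ?_
  rw [hy α (degree_le_of_mem_support hp hα), Finset.mul_sum]
  exact Finset.sum_congr rfl fun x _ => by ring

/-- Jensen's inequality for the Riesz functional of a flat moment matrix. -/
theorem IsConvexPoly.eval_le_riesz {k : ℕ} {y : (Fin n →₀ ℕ) → ℝ}
    (hpsd : (momentMatrix k y).PosSemidef)
    (hrank : (momentMatrix k y).rank = (momentMatrix (k - 1) y).rank) (h0 : y 0 = 1)
    {p : MvPolynomial (Fin n) ℝ} (hp : IsConvexPoly p) (hdeg : p.totalDegree ≤ 2 * k) :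
    eval (fun i => riesz y (X i)) p ≤ riesz y p := by
  -- For `k = 0`, `k - 1` truncates to `0` and the rank condition says nothing, but `p` is constant.
  rcases k with - | k
  · rw [totalDegree_eq_zero_iff_eq_C.1 (Nat.le_zero.1 hdeg), eval_C, riesz_C, h0, mul_one]
  obtain ⟨s, w, hw, hy⟩ := exists_atoms_of_rank_eq hpsd hrank
  have hw1 : ∑ x ∈ s, w x = 1 := by
    rw [← h0, hy 0 (by simp)]
    simp
  have hmean : (fun i => riesz y (X i)) = ∑ x ∈ s, w x • x := by
    funext i
    rw [riesz_eq_sum_eval hy (by rw [totalDegree_X]; omega)]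
    simp
  rw [riesz_eq_sum_eval hy hdeg, hmean]
  exact hp.map_sum_le (fun x _ => hw x) hw1 fun x _ => Set.mem_univ x

end Jensen

end SimplifiedRelaxation

end

open SimplifiedRelaxation in
theorem mainTheorem7 (n m : ℕ) (f : MvPolynomial (Fin n) ℝ)
    (g : Fin m → MvPolynomial (Fin n) ℝ) :
    (∀ fstar : ℝ, (fstar : EReal) = SimplifiedRelaxation.optimalValue f g →
      f - MvPolynomial.C fstar ∈ SimplifiedRelaxation.convexModule g →
        SimplifiedRelaxation.primalValue f g = SimplifiedRelaxation.optimalValue f g ∧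
        SimplifiedRelaxation.dualValue f g = SimplifiedRelaxation.optimalValue f g) ∧
    (SimplifiedRelaxation.IsConvexPoly f →
      (∀ j, SimplifiedRelaxation.IsConvexPoly (-(g j))) →
      ∀ y : (Fin n →₀ ℕ) → ℝ, SimplifiedRelaxation.IsPrimalOptimal f g y →
        (SimplifiedRelaxation.momentMatrix (SimplifiedRelaxation.relaxationOrder f g) y).rank =
          (SimplifiedRelaxation.momentMatrix
            (SimplifiedRelaxation.relaxationOrder f g - 1) y).rank →
        SimplifiedRelaxation.primalValue f g = SimplifiedRelaxation.optimalValue f g ∧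
        (fun i => SimplifiedRelaxation.riesz y (MvPolynomial.X i)) ∈
          SimplifiedRelaxation.feasibleSet g ∧
        IsMinOn (fun x : Fin n → ℝ => MvPolynomial.eval x f)
          (SimplifiedRelaxation.feasibleSet g)
          (fun i => SimplifiedRelaxation.riesz y (MvPolynomial.X i))) := by
  refine ⟨fun fstar hstar hmem => ?_, fun hf hg y hopt hrank => ?_⟩
  · have h₁ := le_dualValue_of_sub_mem_convexModule f g hmem
    rw [hstar] at h₁
    have h₂ := dualValue_le_primalValue f g
    have h₃ := primalValue_le_optimalValue f g
    exact ⟨h₃.antisymm (h₁.trans h₂), (h₂.trans h₃).antisymm h₁⟩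
  · obtain ⟨⟨hpsd, hgy, h0⟩, hmin⟩ := hopt
    have hfx := hf.eval_le_riesz hpsd hrank h0 (totalDegree_objective_le f g)
    have hK : (fun i => riesz y (X i)) ∈ feasibleSet g := fun j => by
      have h := (hg j).eval_le_riesz hpsd hrank h0
        (by rw [totalDegree_neg]; exact totalDegree_constraint_le f g j)
      rw [← rieszLinear_apply y (-g j), map_neg, map_neg, rieszLinear_apply] at h
      linarith [hgy j]
    refine ⟨(primalValue_le_optimalValue f g).antisymm ?_, hK, fun x hx => ?_⟩
    · refine le_iInf₂ fun z hz => (iInf₂_le _ hK).trans ?_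
      exact EReal.coe_le_coe_iff.2 (hfx.trans (hmin z hz))
    · have h := hmin _ (monomials_mem_primalFeasible f g hx)
      rw [← eval_eq_riesz] at h
      exact hfx.trans h
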